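/- **Rank-one transformations.** Given a number $w>0$, integers $r_n\ge 2$ and integers $s_{n,i}\ge 0$ ($n\ge 0$, $0\le i<r_n$), construct columns $C_n$ inductively. A column $C_n$ is a finite sequence of $h_n$ disjoint half-open intervals (levels) of equal length, each level regarded as lying directly above the previous one. Start with the single level $C_0=\{[0,w)\}$. Given $C_n$, cut it into $r_n$ subcolumns of equal width, numbered $0,\dots,r_n-1$ from left to right; put $s_{n,i}$ new intervals (spacers) on top of the $i$-th subcolumn; then stack each subcolumn, with its spacers, on top of the subcolumn to its left to obtain $C_{n+1}$. Spacers are taken consecutively on the half-line, each abutting the previously used part. The column map of $C_n$ translates each level of $C_n$ other than the top one onto the level directly above it. The rank-one transformation $T$ is the pointwise limit of the column maps; it is defined on the union $X$ of all levels of all columns, where $X$ is equipped with Lebesgue measure. $T$ has *bounded cuts* if $\sup_n r_n<\infty$. **Skyscrapers.** A rank-one transformation is a (rank-one) *skyscraper transformation* if $w=1$, $r_n=2$ and $s_{n,0}=0$ for all $n$ (cut in two, add spacers only on top of the right subcolumn), and the resulting space is $[0,\infty)$. **Theorem.** Let $T$ be a rank-one transformation with bounded cuts, defined on $X=[0,1)$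 or $X=[0,\infty)$. Then there is a skyscraper transformation $S$, defined on $Y=[0,\infty)$, such that $T\times S$ is ergodic on $X\times Y$ with respect to the product of the Lebesgue measures. -/

import Mathlib

open MeasureTheory

/-- The parameters of a rank-one cutting-and-stacking construction. The initial column `C₀` is the
single interval `[0, width)`. At stage `n` the column `Cₙ` is cut into `cuts n ≥ 2` subcolumns of
equal width, numbered `0, …, cuts n - 1` from left to right, and `spacers n i` spacers are put on
top of the `i`-th subcolumn (values of `spacers n i` with `i ≥ cuts n` are never used). -/
structure RankOne where
  width : ℝ
  width_pos : 0 < width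
  cuts : ℕ → ℕ
  two_le_cuts : ∀ n, 2 ≤ cuts n
  spacers : ℕ → ℕ → ℕ

namespace RankOne

noncomputable section

variable (P : RankOne)

/-- The height `hₙ` (number of levels) of the column `Cₙ`. -/
def height : ℕ → ℕ
  | 0 => 1
  | n + 1 => ∑ i ∈ Finset.range (P.cuts n), (height n + P.spacers n i)

/-- The common length of the levels of the column `Cₙ`. -/
def levelWidth : ℕ → ℝ
  | 0 => P.width
  | n + 1 => levelWidth n / P.cuts n

/-- The height, in `Cₙ₊₁`, of the bottom of the `i`-th subcolumn of `Cₙ`, when each subcolumn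
(with its spacers) is stacked on top of the subcolumn to its left. -/
def subcolumnBase (n i : ℕ) : ℕ :=
  ∑ l ∈ Finset.range i, (P.height n + P.spacers n l)

/-- The index of the subcolumn of `Cₙ` to which the level of height `k` of `Cₙ₊₁` belongs. -/
def subcolumnIndex (n k : ℕ) : ℕ :=
  Nat.findGreatest (fun i => P.subcolumnBase n i ≤ k) (P.cuts n - 1)

/-- The left endpoint of the level of height `k` of the column `Cₙ`, for `k < hₙ`.
Let this level of `Cₙ₊₁` be the `j`-th one in the `i`-th subcolumn. If `j < hₙ`, it is the `i`-th
piece, from the left, of the level of height `j` of `Cₙ`. Otherwise it is a spacer: the spacers of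
this stage are taken in order, each abutting the previous one, the first of them starting
where the part `[0, hₙ * (length of a level))` of the line that is used up by `Cₙ` ends. -/
def left : ℕ → ℕ → ℝ
  | 0, _ => 0
  | n + 1, k =>
    let i := P.subcolumnIndex n k
    let j := k - P.subcolumnBase n i
    if j < P.height n then
      left n j + (i : ℝ) * P.levelWidth (n + 1)
    else
      (P.height n : ℝ) * P.levelWidth n +
        (((∑ l ∈ Finset.range i, P.spacers n l) + (j - P.height n) : ℕ) : ℝ) *
          P.levelWidth (n + 1)

/-- The level `I_{n,k}` of height `k` of the column `Cₙ`, for `k < hₙ`. -/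
def level (n k : ℕ) : Set ℝ :=
  Set.Ico (P.left n k) (P.left n k + P.levelWidth n)

/-- The space `X`: the union of all levels of all columns. -/
def space : Set ℝ :=
  ⋃ n, ⋃ k ∈ Finset.range (P.height n), P.level n k

/-- The column map of `Cₙ`: it translates each level of `Cₙ` other than the top one onto the level
immediately above it. (The levels of `Cₙ` are disjoint, so at most one term is nonzero. Where the
column map is not defined, this function is the identity.) -/
def columnMap (n : ℕ) (x : ℝ) : ℝ :=
  x + ∑ k ∈ Finset.range (P.height n - 1),
    (P.level n k).indicator (fun _ => P.left n (k + 1) - P.left n k) x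

/-- The rank-one transformation: the pointwise limit of the column maps. At each point of `space`
the column maps are eventually defined and constant; off `space` this function is the identity. -/
def map (x : ℝ) : ℝ :=
  Filter.limUnder Filter.atTop (fun n => P.columnMap n x)

/-- The invariant measure: Lebesgue measure on `space`. -/
def measure : Measure ℝ :=
  volume.restrict P.space

/-- Bounded cuts: `sup rₙ < ∞`. -/
def BoundedCuts : Prop :=
  ∃ K : ℕ, ∀ n, P.cuts n ≤ K

/-- Skyscraper constructions: start with `[0, 1)`, at each stage cut into two subcolumns and add
spacers on top of the right one only, so many in total that the space is `[0, ∞)`. -/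
def IsSkyscraper : Prop :=
  P.width = 1 ∧ (∀ n, P.cuts n = 2) ∧ (∀ n, P.spacers n 0 = 0) ∧ P.space = Set.Ici 0

end

end RankOne

namespace RankOne

variable (P : RankOne)

/-! ### Positions of levels on the line -/

/-! Under `T`, the leftmost subcolumn of `C_N` moves onto the next one in exactly `h_N + s_{N,0}`
steps. Every copy of `C_n` (`n ≤ N`) inside `C_N` moves along with it, so after `h_N + s_{N,0} + a'
- a` steps a proportion `1/r_N ≥ 1/K` of level `a` of `C_n` lies in level `a'`
(`exists_subset_level_mapsTo`). A skyscraper with heights `H` does the same with proportion `1/2`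
and time `H (i+1) + d' - d`.

The two times agree if `h_N + s_{N,0} - H (i+1)` is a prescribed integer. The heights of `T` are
unbounded, so `H` can be chosen, growing as fast as needed, to realise every integer at arbitrarily
late stages (`exists_skyscraper_heights`). Then a proportion `1/(2K)`, independent of `n`, of each
product of levels of the `n`-th columns enters any other such product at a common time.

This forces ergodicity (`ergodic_prod_map`): were an invariant set and its complement both non-null,
they would nearly fill two such products at the same stage (`eventually_exists_dense_level_prod`),
and the points carried from one to the other give a contradiction. -/

theorem cuts_pos (n : ℕ) : 0 < P.cuts n :=
  lt_of_lt_of_le two_pos (P.two_le_cuts n)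

theorem subcolumnBase_zero (n : ℕ) : P.subcolumnBase n 0 = 0 := by
  simp [subcolumnBase]

theorem subcolumnBase_succ (n i : ℕ) :
    P.subcolumnBase n (i + 1) = P.subcolumnBase n i + (P.height n + P.spacers n i) :=
  Finset.sum_range_succ _ _

theorem subcolumnBase_one (n : ℕ) : P.subcolumnBase n 1 = P.height n + P.spacers n 0 := by
  rw [subcolumnBase_succ, subcolumnBase_zero, zero_add]

theorem subcolumnBase_mono (n : ℕ) : Monotone (P.subcolumnBase n) :=
  monotone_nat_of_le_succ fun i => by rw [subcolumnBase_succ]; exact Nat.le_add_right _ _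

theorem height_succ (n : ℕ) : P.height (n + 1) = P.subcolumnBase n (P.cuts n) := rfl

theorem subcolumnBase_add_lt {n i j i' : ℕ} (hi : i < i')
    (hj : j < P.height n + P.spacers n i) :
    P.subcolumnBase n i + j < P.subcolumnBase n i' := by
  have := P.subcolumnBase_mono n (Nat.succ_le_of_lt hi)
  rw [Nat.succ_eq_add_one, subcolumnBase_succ] at this
  omega

theorem subcolumnIndex_subcolumnBase_add {n i j : ℕ} (hi : i < P.cuts n)
    (hj : j < P.height n + P.spacers n i) :
    P.subcolumnIndex n (P.subcolumnBase n i + j) = i := by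
  rw [subcolumnIndex, Nat.findGreatest_eq_iff]
  refine ⟨by omega, fun _ => Nat.le_add_right _ _, fun i' h _ h' => ?_⟩
  exact absurd (P.subcolumnBase_add_lt h hj) (not_lt.2 h')

theorem exists_subcolumn {n k : ℕ} (hk : k < P.height (n + 1)) :
    ∃ i < P.cuts n, ∃ j < P.height n + P.spacers n i, k = P.subcolumnBase n i + j := by
  have h0 : P.subcolumnBase n 0 ≤ k := by simp [subcolumnBase_zero]
  have hle : P.subcolumnBase n (P.subcolumnIndex n k) ≤ k :=
    Nat.findGreatest_spec (P := fun i => P.subcolumnBase n i ≤ k) (Nat.zero_le _) h0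
  have hb : P.subcolumnIndex n k ≤ P.cuts n - 1 := Nat.findGreatest_le _
  have hc := P.cuts_pos n
  have hlt : k < P.subcolumnBase n (P.subcolumnIndex n k + 1) := by
    by_contra! h
    rcases hb.lt_or_eq with h1 | h1
    · exact Nat.findGreatest_is_greatest (P := fun i => P.subcolumnBase n i ≤ k)
        (Nat.lt_succ_self _) h1 h
    · rw [h1, Nat.sub_add_cancel hc, ← height_succ] at h
      omega
  rw [subcolumnBase_succ] at hlt
  exact ⟨P.subcolumnIndex n k, by omega, k - P.subcolumnBase n (P.subcolumnIndex n k),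
    by omega, by omega⟩

theorem height_succ_eq (n : ℕ) :
    P.height (n + 1) =
      P.height n * P.cuts n + ∑ l ∈ Finset.range (P.cuts n), P.spacers n l := by
  simp [height, Finset.sum_add_distrib, mul_comm]

theorem two_mul_height_le (n : ℕ) : 2 * P.height n ≤ P.height (n + 1) := by
  rw [height_succ_eq]
  nlinarith [P.two_le_cuts n, Nat.zero_le (∑ l ∈ Finset.range (P.cuts n), P.spacers n l)]

theorem height_pos (n : ℕ) : 0 < P.height n := by
  induction n with
  | zero => exact one_pos
  | succ n ih => have := P.two_mul_height_le n; omega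

theorem lt_height (n : ℕ) : n < P.height n := by
  induction n with
  | zero => exact one_pos
  | succ n ih => have := P.two_mul_height_le n; omega

theorem height_mono : Monotone P.height :=
  monotone_nat_of_le_succ fun n => by have := P.two_mul_height_le n; omega

theorem levelWidth_pos (n : ℕ) : 0 < P.levelWidth n := by
  induction n with
  | zero => exact P.width_pos
  | succ n ih => exact div_pos ih (by exact_mod_cast P.cuts_pos n)

theorem levelWidth_eq (n : ℕ) : P.levelWidth n = P.cuts n * P.levelWidth (n + 1) := by
  have : (P.cuts n : ℝ) ≠ 0 := by exact_mod_cast (P.cuts_pos n).ne'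
  rw [levelWidth]
  field_simp

theorem levelWidth_le (n : ℕ) : P.levelWidth n ≤ P.width * (1 / 2) ^ n := by
  induction n with
  | zero => simp [levelWidth]
  | succ n ih =>
    have h2 : (2 : ℝ) ≤ P.cuts n := by exact_mod_cast P.two_le_cuts n
    have := P.levelWidth_eq n
    have := P.levelWidth_pos (n + 1)
    rw [pow_succ]
    nlinarith

theorem tendsto_levelWidth : Filter.Tendsto P.levelWidth Filter.atTop (nhds 0) := by
  have h : Filter.Tendsto (fun n : ℕ => P.width * (1 / 2 : ℝ) ^ n) Filter.atTop (nhds 0) := by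
    simpa using (tendsto_pow_atTop_nhds_zero_of_lt_one (r := (1 / 2 : ℝ))
      (by norm_num) (by norm_num)).const_mul P.width
  exact squeeze_zero (fun n => (P.levelWidth_pos n).le) P.levelWidth_le h

/-- The rank, from left to right on the line, of the level of height `k` of the column `Cₙ`. -/
def position : ℕ → ℕ → ℕ
  | 0, _ => 0
  | n + 1, k =>
    let i := P.subcolumnIndex n k
    let j := k - P.subcolumnBase n i
    if j < P.height n then position n j * P.cuts n + i
    else P.height n * P.cuts n +
      ((∑ l ∈ Finset.range i, P.spacers n l) + (j - P.height n))

/-- Levels are cells of a uniform grid, so disjointness and covering reduce to arithmetic of natural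
numbers. -/
theorem left_eq (n k : ℕ) : P.left n k = P.position n k * P.levelWidth n := by
  induction n generalizing k with
  | zero => simp [left, position]
  | succ n ih =>
    simp only [left, position]
    split_ifs
    · rw [ih, P.levelWidth_eq n]; push_cast; ring
    · rw [P.levelWidth_eq n]; push_cast; ring

theorem position_subcolumn {n i j : ℕ} (hi : i < P.cuts n) (hj : j < P.height n) :
    P.position (n + 1) (P.subcolumnBase n i + j) = P.position n j * P.cuts n + i := by
  have h := P.subcolumnIndex_subcolumnBase_add hi (Nat.lt_add_right (P.spacers n i) hj)
  simp only [position, h, Nat.add_sub_cancel_left, if_pos hj]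

theorem position_spacer {n i j : ℕ} (hi : i < P.cuts n) (hj : j < P.spacers n i) :
    P.position (n + 1) (P.subcolumnBase n i + (P.height n + j)) =
      P.height n * P.cuts n + ((∑ l ∈ Finset.range i, P.spacers n l) + j) := by
  have h := P.subcolumnIndex_subcolumnBase_add hi (Nat.add_lt_add_left hj (P.height n))
  simp only [position, h, Nat.add_sub_cancel_left, if_neg (Nat.not_lt.2 (Nat.le_add_right _ _))]

theorem exists_subcolumn_or_spacer {n k : ℕ} (hk : k < P.height (n + 1)) :
    (∃ i < P.cuts n, ∃ j < P.height n, k = P.subcolumnBase n i + j) ∨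
      ∃ i < P.cuts n, ∃ j < P.spacers n i, k = P.subcolumnBase n i + (P.height n + j) := by
  obtain ⟨i, hi, j, hj, rfl⟩ := P.exists_subcolumn hk
  rcases lt_or_ge j (P.height n) with h | h
  · exact Or.inl ⟨i, hi, j, h, rfl⟩
  · exact Or.inr ⟨i, hi, j - P.height n, by omega, by omega⟩

theorem sum_spacers_add_lt {n i j i' : ℕ} (hi : i < i') (hj : j < P.spacers n i) :
    (∑ l ∈ Finset.range i, P.spacers n l) + j < ∑ l ∈ Finset.range i', P.spacers n l := by
  have h : ∑ l ∈ Finset.range (i + 1), P.spacers n l ≤ ∑ l ∈ Finset.range i', P.spacers n l :=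
    Finset.sum_le_sum_of_subset (Finset.range_mono (Nat.succ_le_of_lt hi))
  rw [Finset.sum_range_succ] at h
  omega

theorem position_lt {n k : ℕ} (hk : k < P.height n) : P.position n k < P.height n := by
  induction n generalizing k with
  | zero => exact one_pos
  | succ n ih =>
    rcases P.exists_subcolumn_or_spacer hk with ⟨i, hi, j, hj, rfl⟩ | ⟨i, hi, j, hj, rfl⟩
    · rw [P.position_subcolumn hi hj, height_succ_eq]
      have := Nat.mul_le_mul_right (P.cuts n) (Nat.succ_le_of_lt (ih hj))
      rw [Nat.succ_mul] at this
      omega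
    · rw [P.position_spacer hi hj, height_succ_eq]
      have := P.sum_spacers_add_lt hi hj
      omega

/-- Pieces of old levels have ranks below `hₙ rₙ`, and the residue mod `rₙ` recovers the subcolumn;
spacers have the ranks from `hₙ rₙ` on, in order. -/
theorem position_injOn (n : ℕ) : Set.InjOn (P.position n) (Finset.range (P.height n)) := by
  induction n with
  | zero =>
    intro k hk k' hk' _
    simp only [height, Finset.coe_range, Set.mem_Iio] at hk hk'
    omega
  | succ n ih =>
    have key : ∀ {i j : ℕ}, i < P.cuts n → j < P.height n →
        P.position n j * P.cuts n + i < P.height n * P.cuts n := fun {i j} hi hj => by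
      have := Nat.mul_le_mul_right (P.cuts n) (Nat.succ_le_of_lt (P.position_lt hj))
      rw [Nat.succ_mul] at this
      omega
    intro k hk k' hk' h
    rw [Finset.coe_range, Set.mem_Iio] at hk hk'
    rcases P.exists_subcolumn_or_spacer hk with ⟨i, hi, j, hj, rfl⟩ | ⟨i, hi, j, hj, rfl⟩ <;>
    rcases P.exists_subcolumn_or_spacer hk' with
      ⟨i', hi', j', hj', rfl⟩ | ⟨i', hi', j', hj', rfl⟩
    · rw [P.position_subcolumn hi hj, P.position_subcolumn hi' hj'] at h
      have h1 : i = i' := by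
        have := congrArg (· % P.cuts n) h
        simpa [Nat.add_mod, Nat.mod_eq_of_lt hi, Nat.mod_eq_of_lt hi'] using this
      subst h1
      have h2 : P.position n j = P.position n j' :=
        Nat.eq_of_mul_eq_mul_right (P.cuts_pos n) (Nat.add_right_cancel h)
      rw [ih (by simpa using hj) (by simpa using hj') h2]
    · rw [P.position_subcolumn hi hj, P.position_spacer hi' hj'] at h
      have := key hi hj
      omega
    · rw [P.position_spacer hi hj, P.position_subcolumn hi' hj'] at h
      have := key hi' hj'
      omega
    · rw [P.position_spacer hi hj, P.position_spacer hi' hj'] at h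
      rcases lt_trichotomy i i' with h1 | h1 | h1
      · have := P.sum_spacers_add_lt h1 hj
        omega
      · subst h1; omega
      · have := P.sum_spacers_add_lt h1 hj'
        omega

theorem exists_position_eq {n m : ℕ} (hm : m < P.height n) :
    ∃ k < P.height n, P.position n k = m := by
  have h := Finset.surjOn_of_injOn_of_card_le (s := Finset.range (P.height n))
    (t := Finset.range (P.height n)) (P.position n)
    (fun k hk => by simpa using P.position_lt (by simpa using hk)) (P.position_injOn n) le_rfl
  obtain ⟨k, hk, h⟩ := h (by simpa using hm : m ∈ (Finset.range (P.height n) : Set ℕ))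
  exact ⟨k, by simpa using hk, h⟩

/-! ### Levels -/

/-- The condition `0 ≤ x` is needed because `⌊·⌋₊` is `0` on negative numbers. -/
theorem mem_level_iff {n k : ℕ} {x : ℝ} :
    x ∈ P.level n k ↔ 0 ≤ x ∧ ⌊x / P.levelWidth n⌋₊ = P.position n k := by
  have hw := P.levelWidth_pos n
  rw [level, left_eq, Set.mem_Ico, ← le_div_iff₀ hw, ← add_one_mul, ← div_lt_iff₀ hw]
  constructor
  · intro h
    have h0 : 0 ≤ x / P.levelWidth n := le_trans (Nat.cast_nonneg _) h.1
    refine ⟨?_, (Nat.floor_eq_iff h0).2 h⟩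
    by_contra! hx
    exact absurd h0 (not_le.2 (div_neg_of_neg_of_pos hx hw))
  · rintro ⟨h0, h⟩
    exact (Nat.floor_eq_iff (div_nonneg h0 hw.le)).1 h

theorem level_index_unique {n k k' : ℕ} {x : ℝ} (hk : k < P.height n) (hk' : k' < P.height n)
    (h : x ∈ P.level n k) (h' : x ∈ P.level n k') : k = k' :=
  P.position_injOn n (by simpa using hk) (by simpa using hk')
    ((P.mem_level_iff.1 h).2.symm.trans (P.mem_level_iff.1 h').2)

theorem exists_mem_level_iff {n : ℕ} {x : ℝ} :
    (∃ k < P.height n, x ∈ P.level n k) ↔ 0 ≤ x ∧ x < P.height n * P.levelWidth n := by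
  have hw := P.levelWidth_pos n
  constructor
  · rintro ⟨k, hk, hx⟩
    obtain ⟨h0, h⟩ := P.mem_level_iff.1 hx
    have := P.position_lt hk
    rw [← h, Nat.floor_lt (div_nonneg h0 hw.le), div_lt_iff₀ hw] at this
    exact ⟨h0, this⟩
  · rintro ⟨h0, h⟩
    rw [← div_lt_iff₀ hw, ← Nat.floor_lt (div_nonneg h0 hw.le)] at h
    obtain ⟨k, hk, h⟩ := P.exists_position_eq h
    exact ⟨k, hk, P.mem_level_iff.2 ⟨h0, h.symm⟩⟩

/-- The union of the levels of the column `Cₙ`. -/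
def column (n : ℕ) : Set ℝ :=
  Set.Ico 0 (P.height n * P.levelWidth n)

theorem mem_column_iff {n : ℕ} {x : ℝ} : x ∈ P.column n ↔ ∃ k < P.height n, x ∈ P.level n k :=
  P.exists_mem_level_iff.symm

theorem column_eq (n : ℕ) : P.column n = ⋃ k ∈ Finset.range (P.height n), P.level n k := by
  ext x
  simp [mem_column_iff]

theorem space_eq : P.space = ⋃ n, P.column n := by
  simp only [space, column_eq]

theorem measurableSet_level (n k : ℕ) : MeasurableSet (P.level n k) := measurableSet_Ico

theorem measurableSet_column (n : ℕ) : MeasurableSet (P.column n) := measurableSet_Ico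

theorem measurableSet_space : MeasurableSet P.space := by
  rw [space_eq]
  exact MeasurableSet.iUnion P.measurableSet_column

theorem column_mono : Monotone P.column := by
  refine monotone_nat_of_le_succ fun n => Set.Ico_subset_Ico_right ?_
  rw [P.levelWidth_eq n, height_succ_eq]
  push_cast
  have := P.levelWidth_pos (n + 1)
  have : 0 ≤ (∑ l ∈ Finset.range (P.cuts n), (P.spacers n l : ℝ)) * P.levelWidth (n + 1) := by
    positivity
  nlinarith

theorem volume_level (n k : ℕ) : volume (P.level n k) = ENNReal.ofReal (P.levelWidth n) := by
  simp [level]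

theorem pairwiseDisjoint_level (n : ℕ) :
    (Finset.range (P.height n) : Set ℕ).PairwiseDisjoint (P.level n) := fun k hk k' hk' hne =>
  Set.disjoint_left.2 fun _ h h' =>
    hne (P.level_index_unique (by simpa using hk) (by simpa using hk') h h')

theorem subcolumnBase_add_lt_height {n i j : ℕ} (hi : i < P.cuts n) (hj : j < P.height n) :
    P.subcolumnBase n i + j < P.height (n + 1) :=
  P.subcolumnBase_add_lt hi (Nat.lt_add_right _ hj)

theorem left_subcolumn {n i j : ℕ} (hi : i < P.cuts n) (hj : j < P.height n) :
    P.left (n + 1) (P.subcolumnBase n i + j) = P.left n j + i * P.levelWidth (n + 1) := by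
  rw [left_eq, left_eq, P.position_subcolumn hi hj, P.levelWidth_eq n]
  push_cast
  ring

theorem level_subcolumn_subset {n i j : ℕ} (hi : i < P.cuts n) (hj : j < P.height n) :
    P.level (n + 1) (P.subcolumnBase n i + j) ⊆ P.level n j := by
  rw [level, level, P.left_subcolumn hi hj, P.levelWidth_eq n]
  have := P.levelWidth_pos (n + 1)
  have hi' : (i : ℝ) + 1 ≤ P.cuts n := by exact_mod_cast hi
  exact Set.Ico_subset_Ico (by nlinarith [Nat.cast_nonneg (α := ℝ) i]) (by nlinarith)

theorem exists_mem_level_subcolumn {n j : ℕ} {x : ℝ} (hj : j < P.height n)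
    (hx : x ∈ P.level n j) :
    ∃ i < P.cuts n, x ∈ P.level (n + 1) (P.subcolumnBase n i + j) := by
  have hw := P.levelWidth_pos (n + 1)
  have h0 := (P.mem_level_iff.1 hx).1
  rw [level, P.levelWidth_eq n, Set.mem_Ico] at hx
  have h1 : 0 ≤ (x - P.left n j) / P.levelWidth (n + 1) :=
    div_nonneg (sub_nonneg.2 hx.1) hw.le
  have hi : ⌊(x - P.left n j) / P.levelWidth (n + 1)⌋₊ < P.cuts n := by
    rw [Nat.floor_lt h1, div_lt_iff₀ hw]
    linarith
  refine ⟨_, hi, ?_⟩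
  have h2 := Nat.floor_le h1
  have h3 := Nat.lt_floor_add_one ((x - P.left n j) / P.levelWidth (n + 1))
  rw [le_div_iff₀ hw] at h2
  rw [div_lt_iff₀ hw] at h3
  rw [level, P.left_subcolumn hi hj, Set.mem_Ico]
  constructor <;> nlinarith

/-! ### The transformation -/

theorem columnMap_of_mem {n k : ℕ} {x : ℝ} (hk : k + 1 < P.height n) (hx : x ∈ P.level n k) :
    P.columnMap n x = x + (P.left n (k + 1) - P.left n k) := by
  rw [columnMap, Finset.sum_eq_single k, Set.indicator_of_mem hx]
  · intro k' hk' hne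
    rw [Finset.mem_range] at hk'
    exact Set.indicator_of_notMem
      (fun h => hne (P.level_index_unique (by omega) (by omega) h hx)) _
  · intro h
    rw [Finset.mem_range] at h
    omega

theorem columnMap_succ {n k : ℕ} {x : ℝ} (hk : k + 1 < P.height n) (hx : x ∈ P.level n k) :
    P.columnMap (n + 1) x = P.columnMap n x := by
  obtain ⟨i, hi, hxi⟩ := P.exists_mem_level_subcolumn (Nat.lt_of_succ_lt hk) hx
  have hlt := P.subcolumnBase_add_lt_height hi hk
  rw [← add_assoc] at hlt
  rw [P.columnMap_of_mem hlt hxi,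
    P.columnMap_of_mem hk hx, add_assoc, P.left_subcolumn hi hk,
    P.left_subcolumn hi (Nat.lt_of_succ_lt hk)]
  ring

theorem columnMap_eq_of_le {n m k : ℕ} {x : ℝ} (hk : k + 1 < P.height n) (hx : x ∈ P.level n k)
    (hm : n ≤ m) : P.columnMap m x = P.columnMap n x := by
  induction m, hm using Nat.le_induction generalizing x with
  | base => rfl
  | succ m hm ih =>
    -- A point below the top level stays below the top level in all later columns.
    suffices h : ∃ k', k' + 1 < P.height m ∧ x ∈ P.level m k' by
      obtain ⟨k', hk', hx'⟩ := h
      rw [P.columnMap_succ hk' hx', ih hx]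
    clear ih
    induction m, hm using Nat.le_induction with
    | base => exact ⟨k, hk, hx⟩
    | succ m _ ih =>
      obtain ⟨k', hk', hx'⟩ := ih
      obtain ⟨i, hi, hxi⟩ := P.exists_mem_level_subcolumn (Nat.lt_of_succ_lt hk') hx'
      have hlt := P.subcolumnBase_add_lt_height hi hk'
      rw [← add_assoc] at hlt
      exact ⟨_, hlt, hxi⟩

theorem map_of_mem {n k : ℕ} {x : ℝ} (hk : k + 1 < P.height n) (hx : x ∈ P.level n k) :
    P.map x = x + (P.left n (k + 1) - P.left n k) := by
  have h : Filter.Tendsto (fun m => P.columnMap m x) Filter.atTop (nhds (P.columnMap n x)) :=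
    tendsto_const_nhds.congr' (Filter.eventually_atTop.2
      ⟨n, fun m hm => (P.columnMap_eq_of_le hk hx hm).symm⟩)
  rw [map, h.limUnder_eq, P.columnMap_of_mem hk hx]

theorem tendsto_columnMap (x : ℝ) :
    Filter.Tendsto (fun n => P.columnMap n x) Filter.atTop (nhds (P.map x)) := by
  by_cases h : ∃ n k, k + 1 < P.height n ∧ x ∈ P.level n k
  · obtain ⟨n, k, hk, hx⟩ := h
    rw [P.map_of_mem hk hx, ← P.columnMap_of_mem hk hx]
    exact tendsto_const_nhds.congr' (Filter.eventually_atTop.2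
      ⟨n, fun m hm => (P.columnMap_eq_of_le hk hx hm).symm⟩)
  -- Where no column map is defined, all of them are the identity, so the limit exists on the whole
  -- line and `map` is measurable.
  · have h1 : ∀ n, P.columnMap n x = x := fun n => by
      rw [columnMap, Finset.sum_eq_zero, add_zero]
      intro k hk
      rw [Finset.mem_range] at hk
      exact Set.indicator_of_notMem (fun hx => h ⟨n, k, by omega, hx⟩) _
    simp only [map, h1]
    rw [tendsto_const_nhds.limUnder_eq]
    exact tendsto_const_nhds

theorem measurable_columnMap (n : ℕ) : Measurable (P.columnMap n) :=
  measurable_id.add (Finset.measurable_fun_sum _ fun k _ =>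
    measurable_const.indicator (P.measurableSet_level n k))

theorem measurable_map : Measurable P.map :=
  measurable_of_tendsto_metrizable P.measurable_columnMap
    (tendsto_pi_nhds.2 P.tendsto_columnMap)

theorem iterate_map_mem_level {n k : ℕ} {x : ℝ} (m : ℕ) (hk : k + m < P.height n)
    (hx : x ∈ P.level n k) : P.map^[m] x ∈ P.level n (k + m) := by
  induction m with
  | zero => exact hx
  | succ m ih =>
    have h := ih (by omega)
    rw [Function.iterate_succ_apply', P.map_of_mem (by omega) h]
    simp only [level, Set.mem_Ico] at h ⊢
    rw [← add_assoc k m 1]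
    constructor <;> linarith

/-! ### Invariance of the measure -/

theorem volume_column_inter (n : ℕ) {B : Set ℝ} (hB : MeasurableSet B) :
    volume (P.column n ∩ B) = ∑ k ∈ Finset.range (P.height n), volume (P.level n k ∩ B) := by
  rw [column_eq, Set.iUnion₂_inter, measure_biUnion_finset]
  · exact fun k hk k' hk' hne => (P.pairwiseDisjoint_level n hk hk' hne).mono
      Set.inter_subset_left Set.inter_subset_left
  · exact fun k _ => (P.measurableSet_level n k).inter hB

theorem volume_level_inter_preimage {n k : ℕ} (hk : k + 1 < P.height n) (B : Set ℝ) :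
    volume (P.level n k ∩ P.map ⁻¹' B) = volume (P.level n (k + 1) ∩ B) := by
  rw [← measure_preimage_add_right volume (P.left n (k + 1) - P.left n k)
    (P.level n (k + 1) ∩ B)]
  congr 1
  ext x
  simp only [Set.mem_inter_iff, Set.mem_preimage]
  have h : x ∈ P.level n k ↔ x + (P.left n (k + 1) - P.left n k) ∈ P.level n (k + 1) := by
    simp only [level, Set.mem_Ico]
    constructor <;> rintro ⟨h1, h2⟩ <;> constructor <;> linarith
  rw [← h]
  exact and_congr_right fun hx => by rw [P.map_of_mem hk hx]

theorem volume_level_inter_le (n k : ℕ) (B : Set ℝ) :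
    volume (P.level n k ∩ B) ≤ ENNReal.ofReal (P.levelWidth n) :=
  (measure_mono Set.inter_subset_left).trans (P.volume_level n k).le

/-- All levels but the top are translated onto all levels but the bottom, so the error is at most
one level; it vanishes in the limit. -/
theorem volume_column_inter_preimage_le (n : ℕ) {B : Set ℝ} (hB : MeasurableSet B) :
    volume (P.column n ∩ P.map ⁻¹' B) ≤
      volume (P.column n ∩ B) + ENNReal.ofReal (P.levelWidth n) ∧
    volume (P.column n ∩ B) ≤
      volume (P.column n ∩ P.map ⁻¹' B) + ENNReal.ofReal (P.levelWidth n) := by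
  rw [P.volume_column_inter n hB, P.volume_column_inter n (P.measurable_map hB)]
  obtain ⟨m, hm⟩ := Nat.exists_eq_succ_of_ne_zero (P.height_pos n).ne'
  rw [hm, Nat.succ_eq_add_one, Finset.sum_range_succ,
    Finset.sum_range_succ' (fun k => volume (P.level n k ∩ B)),
    Finset.sum_congr rfl fun k hk => P.volume_level_inter_preimage
      (by rw [Finset.mem_range] at hk; omega) B]
  constructor
  · exact add_le_add le_self_add (P.volume_level_inter_le _ _ _)
  · exact add_le_add le_self_add (P.volume_level_inter_le _ _ _)

theorem tendsto_volume_column_inter (B : Set ℝ) :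
    Filter.Tendsto (fun n => volume (P.column n ∩ B)) Filter.atTop
      (nhds (volume (P.space ∩ B))) := by
  rw [space_eq, Set.iUnion_inter]
  exact tendsto_measure_iUnion_atTop
    fun m n h => Set.inter_subset_inter_left B (P.column_mono h)

theorem measurePreserving_map : MeasurePreserving P.map P.measure P.measure := by
  refine ⟨P.measurable_map, Measure.ext fun B hB => ?_⟩
  rw [Measure.map_apply P.measurable_map hB, measure,
    Measure.restrict_apply (P.measurable_map hB), Measure.restrict_apply hB,
    Set.inter_comm, Set.inter_comm B]
  have hw : Filter.Tendsto (fun n => ENNReal.ofReal (P.levelWidth n)) Filter.atTop (nhds 0) := by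
    simpa using ENNReal.tendsto_ofReal P.tendsto_levelWidth
  have h (C : Set ℝ) := (P.tendsto_volume_column_inter C).add hw
  simp only [add_zero] at h
  exact le_antisymm
    (le_of_tendsto_of_tendsto' (P.tendsto_volume_column_inter _) (h B)
      fun n => (P.volume_column_inter_preimage_le n hB).1)
    (le_of_tendsto_of_tendsto' (P.tendsto_volume_column_inter _) (h _)
      fun n => (P.volume_column_inter_preimage_le n hB).2)

/-! ### Copies of a column inside a later one -/

/-- `D` collects the base heights of the copies of `Cₙ` in `C_N`; the cardinality says that these
copies exhaust `Cₙ`. -/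
theorem exists_copies {n N : ℕ} (h : n ≤ N) :
    ∃ D : Finset ℕ, (D.card : ℝ) * P.levelWidth N = P.levelWidth n ∧
      ∀ b ∈ D, ∀ a < P.height n, b + a < P.height N ∧ P.level N (b + a) ⊆ P.level n a := by
  induction N, h using Nat.le_induction with
  | base => exact ⟨{0}, by simp, by simp⟩
  | succ N _ ih =>
    obtain ⟨D, hD, hsub⟩ := ih
    have hlt : ∀ b ∈ D, b < P.height N := fun b hb => (hsub b hb 0 (P.height_pos n)).1
    refine ⟨(Finset.range (P.cuts N) ×ˢ D).image fun p => P.subcolumnBase N p.1 + p.2, ?_, ?_⟩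
    · rw [Finset.card_image_of_injOn, Finset.card_product, Finset.card_range, ← hD,
        P.levelWidth_eq N]
      · push_cast; ring
      · rintro ⟨i, b⟩ hp ⟨i', b'⟩ hp' heq
        simp only [Finset.coe_product, Set.mem_prod, Finset.coe_range, Set.mem_Iio,
          Finset.mem_coe] at hp hp'
        simp only at heq
        have h1 := P.subcolumnIndex_subcolumnBase_add hp.1
          (Nat.lt_add_right (P.spacers N i) (hlt b hp.2))
        have h2 := P.subcolumnIndex_subcolumnBase_add hp'.1
          (Nat.lt_add_right (P.spacers N i') (hlt b' hp'.2))
        rw [heq, h2] at h1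
        subst h1
        exact Prod.ext rfl (Nat.add_left_cancel heq)
    · simp only [Finset.mem_image, Finset.mem_product, Finset.mem_range, Prod.exists]
      rintro _ ⟨i, b, ⟨hi, hb⟩, rfl⟩ a ha
      obtain ⟨h1, h2⟩ := hsub b hb a ha
      rw [add_assoc]
      exact ⟨P.subcolumnBase_add_lt_height hi h1, (P.level_subcolumn_subset hi h1).trans h2⟩

/-- Moving the leftmost subcolumn of `C_N` onto the next one carries a definite proportion of each
level of `Cₙ`, up to a shift of heights, into each other level of `Cₙ`. -/
theorem exists_subset_level_mapsTo {n N a a' m : ℕ} (h : n ≤ N) (ha : a < P.height n)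
    (ha' : a' < P.height n) (hm : m + a = P.height N + P.spacers N 0 + a') :
    ∃ Q ⊆ P.level n a,
      volume Q = ENNReal.ofReal (P.levelWidth n / P.cuts N) ∧
      Set.MapsTo P.map^[m] Q (P.level n a') := by
  obtain ⟨D, hD, hsub⟩ := P.exists_copies h
  have h0 : 0 < P.cuts N := P.cuts_pos N
  have h1 : 1 < P.cuts N := P.two_le_cuts N
  have hlt : ∀ b ∈ D, b + a < P.height (N + 1) := fun b hb =>
    (hsub b hb a ha).1.trans_le (P.height_mono (Nat.le_succ N))
  have hsub0 : ∀ b ∈ D, P.level (N + 1) (b + a) ⊆ P.level N (b + a) := fun b hb => by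
    simpa [subcolumnBase_zero] using P.level_subcolumn_subset h0 (hsub b hb a ha).1
  -- As the leftmost subcolumn has base `0`, these are the leftmost pieces of the copies of level
  -- `a`.
  refine ⟨⋃ b ∈ D, P.level (N + 1) (b + a),
    Set.iUnion₂_subset fun b hb => (hsub0 b hb).trans (hsub b hb a ha).2, ?_, ?_⟩
  · rw [measure_biUnion_finset]
    · simp only [volume_level, Finset.sum_const, nsmul_eq_mul]
      rw [← ENNReal.ofReal_natCast, ← ENNReal.ofReal_mul (Nat.cast_nonneg _), ← hD, levelWidth,
        mul_div_assoc]
    · intro b hb b' hb' hne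
      exact P.pairwiseDisjoint_level (N + 1) (by simpa using hlt b hb)
        (by simpa using hlt b' hb') (fun h => hne (Nat.add_right_cancel h))
    · exact fun b _ => P.measurableSet_level _ _
  · intro x hx
    simp only [Set.mem_iUnion] at hx
    obtain ⟨b, hb, hx⟩ := hx
    obtain ⟨h2, h3⟩ := hsub b hb a' ha'
    have h4 : b + a + m = P.subcolumnBase N 1 + (b + a') := by rw [subcolumnBase_one]; omega
    have h5 := P.iterate_map_mem_level m
      (by rw [h4]; exact P.subcolumnBase_add_lt_height h1 h2) hx
    rw [h4] at h5
    exact h3 (P.level_subcolumn_subset h1 h2 h5)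

/-! ### Products -/

variable (Q : RankOne)

theorem level_subset_space {n k : ℕ} (hk : k < P.height n) : P.level n k ⊆ P.space := by
  rw [space_eq]
  exact fun x hx => Set.mem_iUnion.2 ⟨n, P.mem_column_iff.2 ⟨k, hk, hx⟩⟩

theorem exists_level_succ {n k : ℕ} {x : ℝ} (hk : k < P.height n) (hx : x ∈ P.level n k) :
    ∃ k' < P.height (n + 1), x ∈ P.level (n + 1) k' ∧ P.level (n + 1) k' ⊆ P.level n k := by
  obtain ⟨i, hi, hxi⟩ := P.exists_mem_level_subcolumn hk hx
  exact ⟨_, P.subcolumnBase_add_lt_height hi hk, hxi, P.level_subcolumn_subset hi hk⟩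

theorem abs_sub_lt_of_mem_level {n k : ℕ} {x y : ℝ} (hx : x ∈ P.level n k)
    (hy : y ∈ P.level n k) : |y - x| < P.levelWidth n := by
  simp only [level, Set.mem_Ico] at hx hy
  rw [abs_sub_lt_iff]
  constructor <;> linarith

theorem eventually_mem_level_small {x : ℝ} (hx : x ∈ P.space) {r : ℝ} (hr : 0 < r) :
    ∀ᶠ n in Filter.atTop, ∃ k < P.height n, x ∈ P.level n k ∧
      P.level n k ⊆ Metric.ball x r := by
  rw [space_eq, Set.mem_iUnion] at hx
  obtain ⟨n₀, hx⟩ := hx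
  filter_upwards [P.tendsto_levelWidth.eventually_lt_const hr, Filter.eventually_ge_atTop n₀]
    with n hn hn₀
  obtain ⟨k, hk, hxk⟩ := P.mem_column_iff.1 (P.column_mono hn₀ hx)
  refine ⟨k, hk, hxk, fun y hy => ?_⟩
  rw [Metric.mem_ball, Real.dist_eq]
  exact (P.abs_sub_lt_of_mem_level hxk hy).trans hn

/-- A set of positive measure nearly fills a product of levels of `Cₙ`, for all large `n`. -/
theorem eventually_exists_dense_level_prod {A : Set (ℝ × ℝ)} (hA : MeasurableSet A)
    (hsub : A ⊆ P.space ×ˢ Q.space) (hpos : volume A ≠ 0) {ε : ENNReal} (hε : ε ≠ 0) :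
    ∀ᶠ n in Filter.atTop, ∃ a < P.height n, ∃ d < Q.height n,
      volume ((P.level n a ×ˢ Q.level n d) \ A) < ε * volume (P.level n a ×ˢ Q.level n d) := by
  obtain ⟨B, hB, hBA, hB0, hBfin⟩ := Measure.exists_subset_measure_lt_top hA
    (pos_iff_ne_zero.2 hpos)
  -- The excess of `U` over `B` is kept below `ε` times half of `B`, because only half of `B` need
  -- be covered by the rectangles inside `U`.
  have hδ : ε * (volume B / 2) ≠ 0 := mul_ne_zero hε (ENNReal.half_pos hB0.ne').ne'
  obtain ⟨U, hBU, hU, hUlt⟩ := B.exists_isOpen_lt_add hBfin.ne hδ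
  classical
  set F : ℕ → Finset (ℕ × ℕ) := fun n =>
    (Finset.range (P.height n) ×ˢ Finset.range (Q.height n)).filter
      fun p => P.level n p.1 ×ˢ Q.level n p.2 ⊆ U with hF
  set V : ℕ → Set (ℝ × ℝ) := fun n => ⋃ p ∈ F n, P.level n p.1 ×ˢ Q.level n p.2 with hV
  have hmem : ∀ n z, z ∈ V n ↔ ∃ a < P.height n, ∃ d < Q.height n,
      P.level n a ×ˢ Q.level n d ⊆ U ∧ z ∈ P.level n a ×ˢ Q.level n d := fun n z => by
    simp only [hV, hF, Set.mem_iUnion, Finset.mem_filter, Finset.mem_product, Finset.mem_range,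
      exists_prop, Prod.exists]
    constructor
    · rintro ⟨a, d, ⟨⟨ha, hd⟩, h⟩, hz⟩
      exact ⟨a, ha, d, hd, h, hz⟩
    · rintro ⟨a, ha, d, hd, h, hz⟩
      exact ⟨a, d, ⟨⟨ha, hd⟩, h⟩, hz⟩
  have hmono : Monotone V := monotone_nat_of_le_succ fun n z hz => by
    obtain ⟨a, ha, d, hd, h, hz⟩ := (hmem n z).1 hz
    obtain ⟨a', ha', hz1, h1⟩ := P.exists_level_succ ha hz.1
    obtain ⟨d', hd', hz2, h2⟩ := Q.exists_level_succ hd hz.2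
    exact (hmem _ z).2 ⟨a', ha', d', hd', (Set.prod_mono h1 h2).trans h, hz1, hz2⟩
  have hcover : B ⊆ ⋃ n, V n := fun z hz => by
    obtain ⟨r, hr, hball⟩ := Metric.isOpen_iff.1 hU z (hBU hz)
    obtain ⟨hz1, hz2⟩ := hsub (hBA hz)
    obtain ⟨n, ⟨a, ha, h1, h1'⟩, d, hd, h2, h2'⟩ := ((P.eventually_mem_level_small hz1 hr).and
      (Q.eventually_mem_level_small hz2 hr)).exists
    refine Set.mem_iUnion.2 ⟨n, (hmem n z).2 ⟨a, ha, d, hd, ?_, h1, h2⟩⟩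
    refine (Set.prod_mono h1' h2').trans ?_
    rwa [ball_prod_same]
  have hlim : Filter.Tendsto (fun n => volume (B ∩ V n)) Filter.atTop (nhds (volume B)) := by
    have := tendsto_measure_iUnion_atTop (μ := (volume : Measure (ℝ × ℝ)))
      (s := fun n => B ∩ V n) fun m n h => Set.inter_subset_inter_right B (hmono h)
    rwa [← Set.inter_iUnion, Set.inter_eq_left.2 hcover] at this
  filter_upwards [hlim.eventually_const_lt (ENNReal.half_lt_self hB0.ne' hBfin.ne)] with n hn
  -- Otherwise every rectangle in `V n` loses a proportion `ε`, hence `V n \ B` has measure at least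
  -- `ε * volume (V n)`, too much for a subset of `U \ B`.
  by_contra! hcon
  have hmeas : ∀ p : ℕ × ℕ, MeasurableSet (P.level n p.1 ×ˢ Q.level n p.2) := fun p =>
    (P.measurableSet_level n p.1).prod (Q.measurableSet_level n p.2)
  have hdisj : (F n : Set (ℕ × ℕ)).PairwiseDisjoint
      fun p => P.level n p.1 ×ˢ Q.level n p.2 := by
    intro p hp q hq hne
    simp only [hF, Finset.coe_filter, Finset.mem_product, Finset.mem_range,
      Set.mem_ofPred_eq] at hp hq
    refine Set.disjoint_left.2 fun z hz hz' => hne (Prod.ext ?_ ?_)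
    · exact P.level_index_unique hp.1.1 hq.1.1 hz.1 hz'.1
    · exact Q.level_index_unique hp.1.2 hq.1.2 hz.2 hz'.2
  have h1 : ε * volume (V n) ≤ volume (V n \ B) := by
    have hdiff : V n \ B = ⋃ p ∈ F n, (P.level n p.1 ×ˢ Q.level n p.2) \ B := by
      simp only [hV, Set.iUnion_sdiff]
    rw [hdiff, measure_biUnion_finset
      (hdisj.mono fun p => Set.sdiff_subset) fun p _ => (hmeas p).diff hB,
      hV, measure_biUnion_finset hdisj fun p _ => hmeas p, Finset.mul_sum]
    refine Finset.sum_le_sum fun p hp => ?_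
    simp only [hF, Finset.mem_filter, Finset.mem_product, Finset.mem_range] at hp
    exact (hcon p.1 hp.1.1 p.2 hp.1.2).trans (measure_mono (Set.sdiff_subset_sdiff_right hBA))
  have h2 : volume (V n \ B) < ε * (volume B / 2) := by
    have hVU : V n ⊆ U := fun z hz => by
      obtain ⟨a, _, d, _, h, hz⟩ := (hmem n z).1 hz
      exact h hz
    refine (measure_mono (Set.sdiff_subset_sdiff_left hVU)).trans_lt ?_
    rw [measure_sdiff hBU hB.nullMeasurableSet hBfin.ne]
    exact ENNReal.sub_lt_of_lt_add (measure_mono hBU) (by rwa [add_comm] at hUlt)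
  exact absurd (h1.trans_lt h2) (not_lt.2 (mul_le_mul_right
    (hn.le.trans (measure_mono Set.inter_subset_right)) ε))

theorem volume_level_prod (n a d : ℕ) : volume (P.level n a ×ˢ Q.level n d) =
    ENNReal.ofReal (P.levelWidth n) * ENNReal.ofReal (Q.levelWidth n) := by
  rw [Measure.volume_eq_prod, Measure.prod_prod, volume_level, volume_level]

theorem measure_prod_eq :
    P.measure.prod Q.measure = volume.restrict (P.space ×ˢ Q.space) := by
  rw [measure, measure, Measure.prod_restrict, Measure.volume_eq_prod]

/-- If a definite proportion of each product of two levels of the `n`-th columns visits each other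
such product, then the product transformation is ergodic. -/
theorem ergodic_prod_map {c : ENNReal} (hc : c ≠ 0)
    (h : ∀ n, ∀ a < P.height n, ∀ a' < P.height n, ∀ d < Q.height n, ∀ d' < Q.height n,
      ∃ m : ℕ, ∃ R ⊆ P.level n a ×ˢ Q.level n d,
        c * volume (P.level n a ×ˢ Q.level n d) ≤ volume R ∧
        Set.MapsTo (Prod.map P.map Q.map)^[m] R (P.level n a' ×ˢ Q.level n d')) :
    Ergodic (Prod.map P.map Q.map) (P.measure.prod Q.measure) := by
  have hPm : SFinite P.measure := by unfold measure; infer_instance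
  have hQm : SFinite Q.measure := by unfold measure; infer_instance
  have hmp : MeasurePreserving (Prod.map P.map Q.map) (P.measure.prod Q.measure)
      (P.measure.prod Q.measure) := P.measurePreserving_map.prod Q.measurePreserving_map
  refine ⟨hmp, ⟨fun {A} hA hinv => ?_⟩⟩
  have hE : MeasurableSet (P.space ×ˢ Q.space) :=
    P.measurableSet_space.prod Q.measurableSet_space
  rw [Filter.eventuallyConst_set', ae_eq_empty, ae_eq_univ, measure_prod_eq,
    Measure.restrict_apply hA, Measure.restrict_apply hA.compl]
  by_contra! hne
  have hε : c / 2 ≠ 0 := (ENNReal.half_pos hc).ne'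
  -- Density holds for all large stages, so one `n` serves both sets, and the two rectangles have
  -- equal measure.
  obtain ⟨n, ⟨a, ha, d, hd, h1⟩, a', ha', d', hd', h2⟩ :=
    ((P.eventually_exists_dense_level_prod Q (hA.inter hE) Set.inter_subset_right
      hne.1 hε).and (P.eventually_exists_dense_level_prod Q (hA.compl.inter hE)
      Set.inter_subset_right hne.2 hε)).exists
  obtain ⟨m, R, hR, hRvol, hmaps⟩ := h n a ha a' ha' d hd d' hd'
  have hR' : MeasurableSet (P.level n a' ×ˢ Q.level n d') :=
    (P.measurableSet_level n a').prod (Q.measurableSet_level n d')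
  have hsub : P.level n a ×ˢ Q.level n d ⊆ P.space ×ˢ Q.space :=
    Set.prod_mono (P.level_subset_space ha) (Q.level_subset_space hd)
  have hAm : (Prod.map P.map Q.map)^[m] ⁻¹' A = A := by
    rw [Set.preimage_iterate_eq]
    exact Function.iterate_fixed hinv m
  -- By invariance `R ∩ A` lands in the part of the target inside `A`, which is less than `c / 2` of
  -- it; `R \ A` is small already in the source.
  have h3 : volume (R ∩ A) ≤ volume ((P.level n a' ×ˢ Q.level n d') \ (Aᶜ ∩ P.space ×ˢ Q.space)) :=
    calc volume (R ∩ A) = (P.measure.prod Q.measure) (R ∩ A) := by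
          rw [measure_prod_eq, Measure.restrict_eq_self]
          exact Set.inter_subset_left.trans (hR.trans hsub)
      _ ≤ (P.measure.prod Q.measure)
          ((Prod.map P.map Q.map)^[m] ⁻¹' ((P.level n a' ×ˢ Q.level n d') ∩ A)) := by
          rw [Set.preimage_inter, hAm]
          exact measure_mono (Set.inter_subset_inter_left A hmaps)
      _ = (P.measure.prod Q.measure) ((P.level n a' ×ˢ Q.level n d') ∩ A) :=
          (hmp.iterate m).measure_preimage (hR'.inter hA).nullMeasurableSet
      _ ≤ volume ((P.level n a' ×ˢ Q.level n d') ∩ A) := by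
          rw [measure_prod_eq]
          exact Measure.restrict_le_self _
      _ ≤ volume ((P.level n a' ×ˢ Q.level n d') \ (Aᶜ ∩ P.space ×ˢ Q.space)) :=
          measure_mono fun z hz => ⟨hz.1, fun hz' => hz'.1 hz.2⟩
  have h4 : volume (R \ A) ≤ volume ((P.level n a ×ˢ Q.level n d) \ (A ∩ P.space ×ˢ Q.space)) :=
    measure_mono fun z hz => ⟨hR hz.1, fun hz' => hz.2 hz'.1⟩
  rw [volume_level_prod] at h1 h2 hRvol
  refine lt_irrefl (c * (ENNReal.ofReal (P.levelWidth n) * ENNReal.ofReal (Q.levelWidth n))) ?_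
  calc _ ≤ volume R := hRvol
    _ ≤ volume (R ∩ A) + volume (R \ A) := measure_le_inter_add_sdiff _ _ _
    _ < _ := ENNReal.add_lt_add (h3.trans_lt h2) (h4.trans_lt h1)
    _ = _ := by rw [← add_mul, ENNReal.add_halves]

/-! ### Skyscrapers with prescribed heights -/

theorem exists_skyscraper_heights (l : ℕ → ℤ) :
    ∃ H : ℕ → ℕ, H 0 = 1 ∧ ∀ i, 3 * H i ≤ H (i + 1) ∧
      ∃ N ≥ i, (H (i + 1) : ℤ) + l i = P.height N + P.spacers N 0 := by
  have step : ∀ i x : ℕ, ∃ y : ℕ, 3 * x ≤ y ∧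
      ∃ N ≥ i, (y : ℤ) + l i = P.height N + P.spacers N 0 := fun i x => by
    have hN := P.lt_height (i + 3 * x + (l i).natAbs)
    -- Since `h_N > N`, subtracting `l i` still leaves at least `3 * x`.
    set N := i + 3 * x + (l i).natAbs with hN'
    exact ⟨((P.height N + P.spacers N 0 : ℤ) - l i).toNat, by omega, N, by omega, by omega⟩
  choose f hf using step
  exact ⟨fun n => Nat.rec 1 f n, rfl, fun i => hf i _⟩

/-- The skyscraper construction with the column heights `H n`. -/
def skyscraper (H : ℕ → ℕ) : RankOne where
  width := 1
  width_pos := one_pos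
  cuts := fun _ => 2
  two_le_cuts := fun _ => le_rfl
  spacers := fun n i => if i = 0 then 0 else H (n + 1) - 2 * H n

/-- The growth condition makes the truncated subtraction in the spacer count exact. -/
theorem skyscraper_height {H : ℕ → ℕ} (h0 : H 0 = 1) (hH : ∀ i, 3 * H i ≤ H (i + 1)) (n : ℕ) :
    (skyscraper H).height n = H n := by
  induction n with
  | zero => exact h0.symm
  | succ n ih =>
    have := hH n
    simp only [height, skyscraper, Finset.sum_range_succ, Finset.sum_range_zero, if_true,
      one_ne_zero, if_false]
    simp only [skyscraper] at ih
    rw [ih]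
    omega

theorem skyscraper_levelWidth (H : ℕ → ℕ) (n : ℕ) :
    (skyscraper H).levelWidth n = (1 / 2) ^ n := by
  induction n with
  | zero => simp [levelWidth, skyscraper]
  | succ n ih => rw [levelWidth, ih, pow_succ]; simp [skyscraper]; ring

/-- The `n`-th column has length `H n / 2 ^ n ≥ (3 / 2) ^ n`, which is unbounded; this is the
purpose of the factor `3`. -/
theorem skyscraper_isSkyscraper {H : ℕ → ℕ} (h0 : H 0 = 1) (hH : ∀ i, 3 * H i ≤ H (i + 1)) :
    (skyscraper H).IsSkyscraper := by
  refine ⟨rfl, fun _ => rfl, fun _ => rfl, ?_⟩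
  have hpow : ∀ n, (3 : ℝ) ^ n ≤ H n := fun n => by
    induction n with
    | zero => simp [h0]
    | succ n ih =>
      have : (3 * H n : ℝ) ≤ H (n + 1) := by exact_mod_cast hH n
      rw [pow_succ]
      linarith
  rw [space_eq]
  ext x
  simp only [column, Set.mem_iUnion, Set.mem_Ico, Set.mem_Ici]
  refine ⟨fun ⟨_, h⟩ => h.1, fun hx => ?_⟩
  obtain ⟨n, hn⟩ := pow_unbounded_of_one_lt x (by norm_num : (1 : ℝ) < 3 / 2)
  refine ⟨n, hx, hn.trans_le ?_⟩
  rw [skyscraper_height h0 hH, skyscraper_levelWidth]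
  calc ((3 : ℝ) / 2) ^ n = 3 ^ n * (1 / 2) ^ n := by rw [← mul_pow]; norm_num
    _ ≤ _ := mul_le_mul_of_nonneg_right (hpow n) (by positivity)

end RankOne

theorem mainTheorem7 (T : RankOne) (hT : T.BoundedCuts)
    (hX : T.space = Set.Ico 0 1 ∨ T.space = Set.Ici 0) :
    ∃ S : RankOne, S.IsSkyscraper ∧
      Ergodic (Prod.map T.map S.map) (T.measure.prod S.measure) := by
  obtain ⟨K, hK⟩ := hT
  have hK0 : 0 < K := (T.cuts_pos 0).trans_le (hK 0)
  obtain ⟨H, h0, hH⟩ :=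
    T.exists_skyscraper_heights fun i => Denumerable.ofNat ℤ (Nat.unpair i).1
  have hH3 := fun i => (hH i).1
  refine ⟨RankOne.skyscraper H, RankOne.skyscraper_isSkyscraper h0 hH3, ?_⟩
  set S := RankOne.skyscraper H with hS
  refine T.ergodic_prod_map S (c := ENNReal.ofReal (1 / K) * ENNReal.ofReal (1 / 2))
    (mul_ne_zero (by simpa using hK0.ne') (by simp)) fun n a ha a' ha' d hd d' hd' => ?_
  -- Pairing the code of the required difference with `n` gives an index `i ≥ n` at which that
  -- difference is realised.
  obtain ⟨N, hN, hl⟩ := (hH (Nat.pair (Encodable.encode ((d' : ℤ) - d - a' + a)) n)).2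
  have hi := Nat.right_le_pair (Encodable.encode ((d' : ℤ) - d - a' + a)) n
  set i := Nat.pair (Encodable.encode ((d' : ℤ) - d - a' + a)) n with hi'
  have hli : Denumerable.ofNat ℤ (Nat.unpair i).1 = (d' : ℤ) - d - a' + a := by
    rw [hi', Nat.unpair_pair, Denumerable.ofNat_encode]
  rw [hli] at hl
  have hNn : T.height n ≤ T.height N := T.height_mono (hi.trans hN)
  obtain ⟨R₁, hR₁, hvol₁, hmaps₁⟩ := T.exists_subset_level_mapsTo
    (m := T.height N + T.spacers N 0 + a' - a) (hi.trans hN) ha ha' (by omega)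
  -- The stage is `i + 1`, where `S` has height `H (i + 1)` and no spacers on the left; `hl` makes
  -- the same time equal to `H (i + 1) + d' - d`.
  obtain ⟨R₂, hR₂, hvol₂, hmaps₂⟩ := S.exists_subset_level_mapsTo
    (m := T.height N + T.spacers N 0 + a' - a) (hi.trans (Nat.le_succ i)) hd hd' (by
      rw [hS, RankOne.skyscraper_height h0 hH3]
      have : (RankOne.skyscraper H).spacers i.succ 0 = 0 := rfl
      rw [this, Nat.succ_eq_add_one]
      omega)
  refine ⟨T.height N + T.spacers N 0 + a' - a, R₁ ×ˢ R₂, Set.prod_mono hR₁ hR₂, ?_, ?_⟩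
  · have hw₁ := T.levelWidth_pos n
    have hw₂ := S.levelWidth_pos n
    have hr : (0 : ℝ) < T.cuts N := by exact_mod_cast T.cuts_pos N
    have hrK : (T.cuts N : ℝ) ≤ K := by exact_mod_cast hK N
    have h2 : (S.cuts i.succ : ℝ) = 2 := by simp [hS, RankOne.skyscraper]
    rw [RankOne.volume_level_prod, Measure.volume_eq_prod, Measure.prod_prod, hvol₁, hvol₂,
      mul_mul_mul_comm, h2, ← ENNReal.ofReal_mul (by positivity),
      ← ENNReal.ofReal_mul (by positivity)]
    refine mul_le_mul' (ENNReal.ofReal_le_ofReal ?_) (ENNReal.ofReal_le_ofReal ?_)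
    · rw [one_div_mul_eq_div]
      exact div_le_div_of_nonneg_left hw₁.le hr hrK
    · rw [one_div_mul_eq_div]
  · rw [Prod.map_iterate]
    exact hmaps₁.prodMap hmaps₂
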